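/- Let $X$ be an infinite-dimensional complex quasi-Banach space, that is, a complex vector space with a function $\|\cdot\|:X\to[0,\infty)$ such that $\|x\|=0$ only if $x=0$, $\|ax\|=|a|\,\|x\|$ for all $a\in\mathbb C$, $x\in X$, and, for some constant $K$, $\|x+y\|\le K(\|x\|+\|y\|)$ for all $x,y\in X$, which is complete for the uniform structure (and topology) that $\|\cdot\|$ induces. Let $T:X\to X$ be a bounded linear operator, i.e. $T$ is linear and there is a constant $C$ with $\|Tx\|\le C\|x\|$ for all $x\in X$. Then there exists $\lambda\in\mathbb C$ such that $T-\lambda I$ is not semi-Fredholm; here a linear operator $S:X\to X$ is called semi-Fredholm if $\ker S$ is finite-dimensional and $S(X)$ is closed in $X$. -/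

import Mathlib

open scoped Uniformity

/-- `q` is a quasi-norm on the complex vector space `X`: it is non-negative, vanishes only at `0`,
is absolutely homogeneous, and satisfies `q (x + y) ≤ K * (q x + q y)` for some constant `K`. -/
structure IsQuasiNorm {X : Type*} [AddCommGroup X] [Module ℂ X] (q : X → ℝ) : Prop where
  nonneg : ∀ x, 0 ≤ q x
  eq_zero : ∀ x, q x = 0 → x = 0
  smul : ∀ (a : ℂ) (x : X), q (a • x) = ‖a‖ * q x
  quasi_triangle : ∃ K : ℝ, ∀ x y, q (x + y) ≤ K * (q x + q y)

/-- `X` is a complex quasi-Banach space with quasi-norm `q`: the uniform structure (hence the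
topology) of `X` is the one induced by `q`, and `X` is complete for it. -/
structure IsQuasiBanach {X : Type*} [AddCommGroup X] [Module ℂ X] [UniformSpace X]
    (q : X → ℝ) : Prop where
  isQuasiNorm : IsQuasiNorm q
  uniformity_hasBasis :
    (𝓤 X).HasBasis (fun r : ℝ => 0 < r) (fun r => {z : X × X | q (z.1 - z.2) < r})
  complete : CompleteSpace X

/-- `T` is bounded from `(X, q)` to `(Y, q')`. -/
def IsBoundedOperator {X Y : Type*} [AddCommGroup X] [Module ℂ X] [AddCommGroup Y] [Module ℂ Y]
    (q : X → ℝ) (q' : Y → ℝ) (T : X →ₗ[ℂ] Y) : Prop :=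
  ∃ C : ℝ, ∀ x, q' (T x) ≤ C * q x

/-- `T` is semi-Fredholm: its kernel is finite-dimensional and its range is closed. -/
def IsSemiFredholm {X Y : Type*} [AddCommGroup X] [Module ℂ X] [AddCommGroup Y] [Module ℂ Y]
    [TopologicalSpace Y] (T : X →ₗ[ℂ] Y) : Prop :=
  FiniteDimensional ℂ (LinearMap.ker T) ∧ IsClosed (Set.range T)

/-! For a polynomial `f`, consider the factor by which `f(T)` can increase the Hausdorff measure of
noncompactness of a set. This factor is an algebra quasi-seminorm on `ℂ[X]`, and by Riesz's theorem
it is at least `1` at the polynomial `1`, because the space is infinite-dimensional.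

A quasi-seminorm only satisfies a triangle inequality up to a constant, so Banach algebra theory
does not apply to it directly. Since `ℂ[X]` is commutative, passing to the spectral radius repairs
this: expanding `(f + g) ^ n` by the binomial theorem and summing dyadically costs a factor
polynomial in `n`, which growth rates do not see (`rate_add`). The radius is thus a genuine algebra
seminorm with value `1` at `1`. Its completion is a nonzero Banach algebra, where a boundary point
`z` of the spectrum of `X` makes `X - z` a topological divisor of zero.

If `T - z` is semi-Fredholm, the open mapping theorem and the finite-dimensional kernel turn nets of
`(T - z)(A)` into nets of `A` at the cost of a constant `c` (`exists_hasNet_of_isSemiFredholm`).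
Iterating, the radius of `f` is at most `c` times that of `(X - z) f`. This cannot hold for every
`z`. -/

open Filter Topology

/-! ### Topological divisors of zero -/

/-- In a complex Banach algebra, `x - z` is a topological divisor of zero for some scalar `z`. -/
theorem exists_forall_norm_sub_algebraMap_mul_lt {A : Type*} [NormedRing A] [NormedAlgebra ℂ A]
    [CompleteSpace A] [Nontrivial A] (x : A) :
    ∃ z : ℂ, ∀ c : ℝ, 0 < c → ∃ y : A, ‖(x - algebraMap ℂ A z) * y‖ < c * ‖y‖ := by
  have hne : (frontier (spectrum ℂ x)).Nonempty := by
    rw [nonempty_frontier_iff]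
    refine ⟨spectrum.nonempty x, fun h => ?_⟩
    have := spectrum.isCompact (𝕜 := ℂ) x
    rw [h] at this
    exact noncompact_univ ℂ this
  obtain ⟨z, hz⟩ := hne
  have hzs : z ∈ spectrum ℂ x := (spectrum.isClosed x).frontier_subset hz
  have hzc : z ∈ closure (spectrum ℂ x)ᶜ := by
    rw [frontier_eq_closure_inter_closure] at hz
    exact hz.2
  refine ⟨z, fun c hc => ?_⟩
  by_contra! h
  have h1 : 0 < ‖(1 : A)‖ := norm_pos_iff.2 one_ne_zero
  -- With `u = x - w` invertible, the first bound on `‖z - w‖` forces `c ‖u⁻¹‖ ≤ 2 ‖1‖`. The second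
  -- then places `x - z` within `‖u⁻¹‖⁻¹` of `u`, so `x - z` would be a unit. The norm of `1` is not
  -- assumed to be `1`.
  obtain ⟨w, hw, hd⟩ := Metric.mem_closure_iff.1 hzc (min (c / 2) (c / (2 * ‖(1 : A)‖ * ‖(1 : A)‖)))
    (by positivity)
  rw [dist_eq_norm, lt_min_iff] at hd
  have hw' : IsUnit (x - algebraMap ℂ A w) := by
    have := spectrum.notMem_iff.1 hw
    simpa using this.neg
  obtain ⟨u, hu⟩ := hw'
  have hv : (x - algebraMap ℂ A z) * (↑u⁻¹ : A) = 1 - (z - w) • (↑u⁻¹ : A) := by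
    have : x - algebraMap ℂ A z = u - algebraMap ℂ A (z - w) := by rw [hu, map_sub]; abel
    rw [this, sub_mul, Units.mul_inv, Algebra.smul_def]
  have hb := h (↑u⁻¹ : A)
  rw [hv] at hb
  have hb2 : ‖(1 : A) - (z - w) • (↑u⁻¹ : A)‖ ≤ ‖(1 : A)‖ + ‖z - w‖ * ‖(↑u⁻¹ : A)‖ := by
    rw [← norm_smul]; exact norm_sub_le _ _
  have hpos : 0 < ‖(↑u⁻¹ : A)‖ := norm_pos_iff.2 (Units.ne_zero _)
  have hinv : c * ‖(↑u⁻¹ : A)‖ ≤ 2 * ‖(1 : A)‖ := by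
    nlinarith [hd.1]
  have hlt : ‖(x - algebraMap ℂ A z) - (u : A)‖ < ‖(↑u⁻¹ : A)‖⁻¹ := by
    have e : (x - algebraMap ℂ A z) - (u : A) = (w - z) • (1 : A) := by
      rw [hu, Algebra.smul_def, map_sub, mul_one]; abel
    rw [e, norm_smul, norm_sub_rev, lt_inv_comm₀ (by
      by_cases hzw : z - w = 0
      · exact absurd (sub_eq_zero.1 hzw ▸ hzs) hw
      · positivity) hpos]
    have hzw : 0 < ‖z - w‖ := norm_pos_iff.2 fun hzw => hw (sub_eq_zero.1 hzw ▸ hzs)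
    rw [lt_inv_comm₀ hpos (by positivity)]
    have := hd.2
    rw [lt_div_iff₀ (by positivity)] at this
    rw [lt_inv_comm₀ (by positivity) hpos, lt_inv_comm₀ hpos (by positivity),
      ← one_div, lt_div_iff₀ hpos]
    have h3 : c * (‖z - w‖ * ‖(1 : A)‖ * ‖(↑u⁻¹ : A)‖) ≤ ‖z - w‖ * ‖(1 : A)‖ * (2 * ‖(1 : A)‖) := by
      nlinarith [mul_le_mul_of_nonneg_left hinv (by positivity : 0 ≤ ‖z - w‖ * ‖(1 : A)‖)]
    nlinarith
  have hunit : IsUnit (x - algebraMap ℂ A z) := ⟨u.ofNearby _ hlt, u.val_ofNearby _ hlt⟩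
  exact spectrum.mem_iff.1 hzs (by simpa using hunit.neg)

/-- The same for an algebra seminorm on a commutative algebra that is not complete. -/
theorem exists_forall_seminorm_sub_algebraMap_mul_lt {R : Type*} [SeminormedCommRing R]
    [NormedAlgebra ℂ R] (h1 : ‖(1 : R)‖ ≠ 0) (x : R) :
    ∃ z : ℂ, ∀ c : ℝ, 0 < c → ∃ y : R, ‖(x - algebraMap ℂ R z) * y‖ < c * ‖y‖ := by
  have : Nontrivial (UniformSpace.Completion R) := by
    refine ⟨⟨((1 : R) : UniformSpace.Completion R), 0, fun h => h1 ?_⟩⟩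
    rw [← UniformSpace.Completion.norm_coe, h, norm_zero]
  obtain ⟨z, hz⟩ := exists_forall_norm_sub_algebraMap_mul_lt (x : UniformSpace.Completion R)
  refine ⟨z, fun c hc => ?_⟩
  by_contra! h
  obtain ⟨y, hy⟩ := hz c hc
  have key : ∀ y : UniformSpace.Completion R, c * ‖y‖ ≤
      ‖((x : UniformSpace.Completion R) - algebraMap ℂ (UniformSpace.Completion R) z) * y‖ := by
    refine fun y => UniformSpace.Completion.induction_on y ?_ fun y => ?_
    · exact isClosed_le (by fun_prop) (by fun_prop)
    · have e : algebraMap ℂ (UniformSpace.Completion R) z = ((algebraMap ℂ R z : R) :) := rfl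
      rw [e, ← UniformSpace.Completion.coe_sub, ← UniformSpace.Completion.coe_mul,
        UniformSpace.Completion.norm_coe, UniformSpace.Completion.norm_coe]
      exact h y
  exact hy.not_ge (key y)

/-! ### The spectral radius of an algebra quasi-seminorm -/

/-- `B f C` behaves like the assertion that `C` is positive and that an algebra quasi-seminorm,
with value `1` at `1`, is at most `C` at `f`. -/
structure IsQuasiBound {R : Type*} [CommRing R] [Algebra ℂ R] (K : ℝ) (B : R → ℝ → Prop) :
    Prop where
  pos : ∀ {f C}, B f C → 0 < C
  mono : ∀ {f C D}, B f C → C ≤ D → B f D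
  add : ∀ {f g C D}, B f C → B g D → B (f + g) (K * (C + D))
  mul : ∀ {f g C D}, B f C → B g D → B (f * g) (C * D)
  smul : ∀ {f C} (a : ℂ), a ≠ 0 → B f C → B (a • f) (‖a‖ * C)
  one : B 1 1
  one_le : ∀ {C}, B 1 C → 1 ≤ C
  exists_bound : ∀ f, ∃ C, B f C

/-- Polynomial growth is dominated by exponential growth. -/
theorem exists_forall_succ_pow_le_mul_pow (a : ℕ) {y : ℝ} (hy : 1 < y) :
    ∃ C : ℝ, 0 < C ∧ ∀ n : ℕ, ((n : ℝ) + 1) ^ a ≤ C * y ^ n := by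
  have h := tendsto_pow_const_mul_const_pow_of_abs_lt_one a (r := y⁻¹)
    (by rw [abs_of_pos (by positivity)]; exact inv_lt_one_of_one_lt₀ hy)
  obtain ⟨M, hM⟩ := h.bddAbove_range
  have hM' : ∀ n : ℕ, (n : ℝ) ^ a * y⁻¹ ^ n ≤ M := fun n => hM ⟨n, rfl⟩
  refine ⟨(|M| + 1) * y, by positivity, fun n => ?_⟩
  have h2 := hM' (n + 1)
  have hyp : 0 < y ^ (n + 1) := by positivity
  rw [inv_pow, ← div_eq_mul_inv, div_le_iff₀ hyp] at h2
  push_cast at h2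
  calc ((n : ℝ) + 1) ^ a ≤ M * y ^ (n + 1) := h2
    _ ≤ (|M| + 1) * y ^ (n + 1) := by
      gcongr; linarith [le_abs_self M]
    _ = _ := by ring

namespace IsQuasiBound

variable {R : Type*} [CommRing R] {K : ℝ} {B : R → ℝ → Prop}

/-- `r` is an exponential growth rate of the powers of `f`. -/
def Rate (B : R → ℝ → Prop) (f : R) (r : ℝ) : Prop :=
  0 < r ∧ ∃ C, 0 < C ∧ ∀ n : ℕ, B (f ^ n) (C * r ^ n)

/-- The infimum of the growth rates, a spectral radius. -/
noncomputable def radius (B : R → ℝ → Prop) (f : R) : ℝ := sInf {r | Rate B f r}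

theorem radius_nonneg (f : R) : 0 ≤ radius B f := Real.sInf_nonneg fun _ hr => hr.1.le

theorem radius_le {f : R} {r : ℝ} (hr : Rate B f r) : radius B f ≤ r :=
  csInf_le ⟨0, fun _ hr => hr.1.le⟩ hr

variable [Algebra ℂ R]

theorem zero (h : IsQuasiBound K B) {C : ℝ} (hC : 0 < C) : B 0 C := by
  obtain ⟨D, hD⟩ := h.exists_bound 0
  have hD0 := h.pos hD
  have := h.smul ((C / D : ℝ) : ℂ) (by exact_mod_cast (div_pos hC hD0).ne') hD
  rwa [smul_zero, Complex.norm_real, Real.norm_eq_abs, abs_of_pos (div_pos hC hD0),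
    div_mul_cancel₀ _ hD0.ne'] at this

theorem pow (h : IsQuasiBound K B) {f : R} {C : ℝ} (hf : B f C) (n : ℕ) : B (f ^ n) (C ^ n) := by
  induction n with
  | zero => simpa using h.one
  | succ n ih => simpa [pow_succ] using h.mul ih hf

/-- Halving the sum `j` times pays the quasi-triangle constant once per level, so the loss is `(2K)
^ j`, polynomial in the number of terms; adding terms one by one would lose exponentially. -/
theorem sum_range_two_pow (h : IsQuasiBound K B) {E : ℝ} (j : ℕ) (f : ℕ → R)
    (hf : ∀ i, B (f i) E) : B (∑ i ∈ Finset.range (2 ^ j), f i) ((2 * K) ^ j * E) := by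
  induction j generalizing f with
  | zero => simpa using hf 0
  | succ j ih =>
    rw [pow_succ, mul_two, Finset.sum_range_add]
    convert h.add (ih f hf) (ih (fun i => f (2 ^ j + i)) fun i => hf _) using 1
    ring

theorem exists_rate (h : IsQuasiBound K B) (f : R) : ∃ r, Rate B f r := by
  obtain ⟨C, hC⟩ := h.exists_bound f
  exact ⟨C, h.pos hC, 1, one_pos, fun n => by simpa using h.pow hC n⟩

theorem rate_zero (h : IsQuasiBound K B) {r : ℝ} (hr : 0 < r) : Rate B 0 r := by
  refine ⟨hr, 1, one_pos, fun n => ?_⟩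
  cases n with
  | zero => simpa using h.one
  | succ n => rw [zero_pow n.succ_ne_zero]; exact h.zero (by positivity)

theorem rate_one (h : IsQuasiBound K B) : Rate B 1 1 :=
  ⟨one_pos, 1, one_pos, fun n => by simpa using h.one⟩

theorem one_le_of_rate_one (h : IsQuasiBound K B) {r : ℝ} (hr : Rate B 1 r) : 1 ≤ r := by
  obtain ⟨hr0, C, hC, hB⟩ := hr
  by_contra! hlt
  obtain ⟨n, hn⟩ := exists_pow_lt_of_lt_one (inv_pos.2 hC) hlt
  have := h.one_le (by simpa using hB n)
  rw [← one_div, lt_div_iff₀ hC] at hn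
  linarith

theorem rate_mul (h : IsQuasiBound K B) {f g : R} {r s : ℝ} (hf : Rate B f r) (hg : Rate B g s) :
    Rate B (f * g) (r * s) := by
  obtain ⟨hr, C, hC, hB⟩ := hf
  obtain ⟨hs, D, hD, hB'⟩ := hg
  refine ⟨by positivity, C * D, by positivity, fun n => ?_⟩
  rw [mul_pow]
  convert h.mul (hB n) (hB' n) using 1
  ring

theorem rate_smul (h : IsQuasiBound K B) {f : R} {r : ℝ} {a : ℂ} (ha : a ≠ 0) (hf : Rate B f r) :
    Rate B (a • f) (‖a‖ * r) := by
  obtain ⟨hr, C, hC, hB⟩ := hf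
  refine ⟨by positivity, C, hC, fun n => ?_⟩
  rw [smul_pow]
  convert h.smul (a ^ n) (pow_ne_zero n ha) (hB n) using 1
  rw [norm_pow]; ring

/-- Each binomial term of `(f + g) ^ n` is at most a constant times `(r + s) ^ n`, and dyadic
summation adds only a polynomial factor in `n`, absorbed by any `t > r + s`. -/
theorem rate_add (h : IsQuasiBound K B) {f g : R} {r s t : ℝ} (hf : Rate B f r) (hg : Rate B g s)
    (ht : r + s < t) : Rate B (f + g) t := by
  obtain ⟨hr, C, hC, hB⟩ := hf
  obtain ⟨hs, D, hD, hB'⟩ := hg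
  have hterm : ∀ n k : ℕ, B (f ^ k * g ^ (n - k) * (n.choose k : R)) (C * D * (r + s) ^ n) := by
    intro n k
    rcases lt_or_ge n k with hk | hk
    · rw [Nat.choose_eq_zero_of_lt hk, Nat.cast_zero, mul_zero]
      exact h.zero (by positivity)
    · have hne : (n.choose k : ℂ) ≠ 0 := by exact_mod_cast (Nat.choose_pos hk).ne'
      have h1 := h.smul _ hne (h.mul (hB k) (hB' (n - k)))
      have e : (n.choose k : ℂ) • (f ^ k * g ^ (n - k)) = f ^ k * g ^ (n - k) * (n.choose k : R) := by
        rw [Algebra.smul_def, map_natCast, mul_comm]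
      rw [e] at h1
      refine h.mono h1 ?_
      rw [Complex.norm_natCast, add_pow]
      have h2 : r ^ k * s ^ (n - k) * (n.choose k : ℝ) ≤
          ∑ m ∈ Finset.range (n + 1), r ^ m * s ^ (n - m) * (n.choose m : ℝ) :=
        Finset.single_le_sum (f := fun m => r ^ m * s ^ (n - m) * (n.choose m : ℝ))
          (fun i _ => by positivity) (Finset.mem_range.2 (by omega))
      calc (n.choose k : ℝ) * (C * r ^ k * (D * s ^ (n - k)))
          = C * D * (r ^ k * s ^ (n - k) * (n.choose k : ℝ)) := by ring
        _ ≤ _ := by gcongr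
  -- With `2 |K| < 2 ^ a`, the dyadic loss `(2K) ^ j` is at most `(2 ^ j) ^ a ≤ (2 (n + 1)) ^ a`.
  obtain ⟨a, ha⟩ := pow_unbounded_of_one_lt (2 * |K|) (one_lt_two : (1 : ℝ) < 2)
  obtain ⟨M, hM, hMn⟩ := exists_forall_succ_pow_le_mul_pow a
    (y := t / (r + s)) (by rw [one_lt_div (by positivity)]; exact ht)
  have ht0 : 0 < t := by linarith
  refine ⟨ht0, 2 ^ a * M * (C * D), by positivity, fun n => ?_⟩
  -- The sum is padded to `2 ^ j` terms; those with `k > n` vanish with their binomial coefficient.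
  set j := Nat.log 2 (n + 1) + 1 with hj
  have hlt : n + 1 < 2 ^ j := Nat.lt_pow_succ_log_self one_lt_two _
  have hle : 2 ^ j ≤ 2 * (n + 1) := by
    rw [hj, pow_succ, mul_comm]
    exact Nat.mul_le_mul_left _ (Nat.pow_log_le_self 2 n.succ_ne_zero)
  have hsum := h.sum_range_two_pow j (fun k => f ^ k * g ^ (n - k) * (n.choose k : R)) (hterm n)
  have e : (f + g) ^ n = ∑ k ∈ Finset.range (2 ^ j), f ^ k * g ^ (n - k) * (n.choose k : R) := by
    rw [add_pow]
    refine Finset.sum_subset (Finset.range_mono hlt.le) fun k _ hk => ?_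
    rw [Nat.choose_eq_zero_of_lt (by simpa using hk), Nat.cast_zero, mul_zero]
  rw [e]
  refine h.mono hsum ?_
  have h3 : (2 * K) ^ j ≤ 2 ^ a * (M * (t / (r + s)) ^ n) := by
    calc (2 * K) ^ j ≤ |2 * K| ^ j := by rw [← abs_pow]; exact le_abs_self _
      _ = (2 * |K|) ^ j := by rw [abs_mul, abs_two]
      _ ≤ (2 ^ a) ^ j := by gcongr
      _ = (2 ^ j) ^ a := by rw [← pow_mul, ← pow_mul, mul_comm]
      _ ≤ (2 * ((n : ℝ) + 1)) ^ a := by gcongr; exact_mod_cast hle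
      _ = 2 ^ a * ((n : ℝ) + 1) ^ a := mul_pow ..
      _ ≤ _ := by gcongr; exact hMn n
  calc (2 * K) ^ j * (C * D * (r + s) ^ n)
      ≤ 2 ^ a * (M * (t / (r + s)) ^ n) * (C * D * (r + s) ^ n) := by gcongr
    _ = 2 ^ a * M * (C * D) * t ^ n := by
      rw [div_pow]; field_simp

theorem exists_rate_lt (h : IsQuasiBound K B) {f : R} {s : ℝ} (hs : radius B f < s) :
    ∃ r < s, Rate B f r := by
  obtain ⟨r, hr, hrs⟩ := exists_lt_of_csInf_lt (h.exists_rate f) hs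
  exact ⟨r, hrs, hr⟩

theorem radius_zero (h : IsQuasiBound K B) : radius B (0 : R) = 0 :=
  le_antisymm (le_of_forall_pos_le_add fun r hr => by
    simpa using radius_le (h.rate_zero hr)) (radius_nonneg _)

theorem radius_one (h : IsQuasiBound K B) : radius B (1 : R) = 1 :=
  le_antisymm (radius_le h.rate_one)
    (le_csInf (h.exists_rate 1) fun _ hr => h.one_le_of_rate_one hr)

theorem radius_add_le (h : IsQuasiBound K B) (f g : R) :
    radius B (f + g) ≤ radius B f + radius B g := by
  refine le_of_forall_pos_le_add fun ε hε => ?_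
  obtain ⟨r, hr, hf⟩ := h.exists_rate_lt (lt_add_of_pos_right (radius B f) (half_pos hε))
  obtain ⟨s, hs, hg⟩ := h.exists_rate_lt (lt_add_of_pos_right (radius B g) (half_pos hε))
  exact radius_le (h.rate_add hf hg (by linarith))

theorem radius_mul_le (h : IsQuasiBound K B) (f g : R) :
    radius B (f * g) ≤ radius B f * radius B g := by
  refine le_of_forall_gt_imp_ge_of_dense fun t ht => ?_
  obtain ⟨a, ha, b, hb, hab⟩ : ∃ a, radius B f < a ∧ ∃ b, radius B g < b ∧ a * b ≤ t := by
    have hc : Tendsto (fun ε : ℝ => (radius B f + ε) * (radius B g + ε)) (𝓝[>] 0)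
        (𝓝 (radius B f * radius B g)) := by
      have : Continuous fun ε : ℝ => (radius B f + ε) * (radius B g + ε) := by fun_prop
      simpa using (this.tendsto 0).mono_left nhdsWithin_le_nhds
    obtain ⟨ε, h1, h2⟩ := ((hc.eventually (gt_mem_nhds ht)).and self_mem_nhdsWithin).exists
    exact ⟨_, lt_add_of_pos_right _ h2, _, lt_add_of_pos_right _ h2, h1.le⟩
  obtain ⟨r, hr, hf⟩ := h.exists_rate_lt ha
  obtain ⟨s, hs, hg⟩ := h.exists_rate_lt hb
  refine (radius_le (h.rate_mul hf hg)).trans (le_trans ?_ hab)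
  exact mul_le_mul hr.le hs.le hg.1.le (hf.1.le.trans hr.le)

theorem radius_smul_le (h : IsQuasiBound K B) (a : ℂ) (f : R) :
    radius B (a • f) ≤ ‖a‖ * radius B f := by
  by_cases ha : a = 0
  · simp [ha, h.radius_zero]
  · have ha' : 0 < ‖a‖ := norm_pos_iff.2 ha
    rw [← div_le_iff₀' ha']
    exact le_csInf (h.exists_rate f) fun r hr => by
      rw [div_le_iff₀' ha']; exact radius_le (h.rate_smul ha hr)

theorem radius_neg (h : IsQuasiBound K B) (f : R) : radius B (-f) = radius B f := by
  have key : ∀ g : R, radius B (-g) ≤ radius B g := fun g => by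
    simpa using h.radius_smul_le (-1) g
  exact le_antisymm (key f) (by simpa using key (-f))

/-- The radius of `x - z` cannot be bounded below by multiplication for every `z`. -/
theorem not_forall_bounded_below (h : IsQuasiBound K B) (x : R) :
    ¬ ∀ z : ℂ, ∃ c : ℝ, 0 < c ∧ ∀ f C, B ((x - algebraMap ℂ R z) * f) C → B f (c * C) := by
  intro H
  let p : RingSeminorm R :=
    { toFun := radius B
      map_zero' := h.radius_zero
      add_le' := h.radius_add_le
      neg' := h.radius_neg
      mul_le' := h.radius_mul_le }
  let : SeminormedCommRing R := { p.toSeminormedRing with mul_comm := mul_comm }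
  let : NormedAlgebra ℂ R := { norm_smul_le := h.radius_smul_le }
  obtain ⟨z, hz⟩ := exists_forall_seminorm_sub_algebraMap_mul_lt (R := R)
    (by change radius B 1 ≠ 0; rw [h.radius_one]; exact one_ne_zero) x
  obtain ⟨c, hc, hB⟩ := H z
  obtain ⟨y, hy⟩ := hz c⁻¹ (inv_pos.2 hc)
  change radius B _ < c⁻¹ * radius B y at hy
  obtain ⟨r, hr, hr0, C, hC, hrB⟩ := h.exists_rate_lt hy
  -- The lower bound is iterated on the quasi-bound itself, so that applied to `y ^ n` it yields the
  -- factor `c ^ n` and hence the rate `c * r`, smaller than the radius of `y`.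
  have hpow : ∀ (n : ℕ) (f : R) (C : ℝ), B ((x - algebraMap ℂ R z) ^ n * f) C → B f (c ^ n * C) := by
    intro n
    induction n with
    | zero => intro f C hf; simpa using hf
    | succ n ih =>
      intro f C hf
      rw [pow_succ, mul_assoc] at hf
      have := hB _ _ (ih _ _ hf)
      rwa [← mul_assoc, ← pow_succ'] at this
  have hy' : Rate B y (c * r) := by
    refine ⟨by positivity, C, hC, fun n => ?_⟩
    have h1 := hrB n
    rw [mul_pow] at h1
    have h2 := hpow n _ _ h1
    rw [mul_pow]
    convert h2 using 1
    ring
  have h3 := radius_le hy'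
  rw [lt_inv_mul_iff₀ hc] at hr
  linarith

end IsQuasiBound

/-! ### Quasi-Banach spaces and the open mapping theorem -/

namespace IsQuasiNorm

variable {X : Type*} [AddCommGroup X] [Module ℂ X] {q : X → ℝ}

theorem map_zero (h : IsQuasiNorm q) : q 0 = 0 := by
  simpa using h.smul 0 0

theorem map_neg (h : IsQuasiNorm q) (x : X) : q (-x) = q x := by
  simpa using h.smul (-1) x

theorem map_sub_rev (h : IsQuasiNorm q) (x y : X) : q (x - y) = q (y - x) := by
  rw [← h.map_neg, neg_sub]

theorem exists_one_le (h : IsQuasiNorm q) :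
    ∃ K : ℝ, 1 ≤ K ∧ ∀ x y, q (x + y) ≤ K * (q x + q y) := by
  obtain ⟨K, hK⟩ := h.quasi_triangle
  refine ⟨max K 1, le_max_right _ _, fun x y => (hK x y).trans ?_⟩
  have := h.nonneg x
  have := h.nonneg y
  gcongr
  exact le_max_left _ _

theorem sub_le (h : IsQuasiNorm q) {K : ℝ} (hK : ∀ x y, q (x + y) ≤ K * (q x + q y)) (x y : X) :
    q (x - y) ≤ K * (q x + q y) := by
  simpa [sub_eq_add_neg, h.map_neg] using hK x (-y)

end IsQuasiNorm

namespace IsQuasiBanach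

variable {X : Type*} [AddCommGroup X] [Module ℂ X] [UniformSpace X] {q : X → ℝ}

theorem nhds_hasBasis (h : IsQuasiBanach q) (x : X) :
    (𝓝 x).HasBasis (fun r : ℝ => 0 < r) fun r => {y | q (y - x) < r} :=
  nhds_basis_uniformity h.uniformity_hasBasis

theorem tendsto_iff (h : IsQuasiBanach q) {ι : Type*} {l : Filter ι} {u : ι → X} {x : X} :
    Tendsto u l (𝓝 x) ↔ ∀ r > 0, ∀ᶠ i in l, q (u i - x) < r :=
  (h.nhds_hasBasis x).tendsto_right_iff

theorem isUniformAddGroup (h : IsQuasiBanach q) : IsUniformAddGroup X := by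
  obtain ⟨K, hK1, hK⟩ := h.isQuasiNorm.exists_one_le
  have hK0 : 0 < K := by linarith
  refine ⟨?_⟩
  rw [UniformContinuous, uniformity_prod_eq_comap_prod,
    (((h.uniformity_hasBasis.prod h.uniformity_hasBasis).comap _).tendsto_iff
      h.uniformity_hasBasis)]
  intro r hr
  refine ⟨(r / (2 * K), r / (2 * K)), ⟨by positivity, by positivity⟩, ?_⟩
  rintro ⟨⟨a, b⟩, ⟨c, d⟩⟩ ⟨h1, h2⟩
  simp only [Set.mem_ofPred_eq] at h1 h2 ⊢
  have e : a - b - (c - d) = (a - c) - (b - d) := by abel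
  rw [e]
  refine (h.isQuasiNorm.sub_le hK _ _).trans_lt ?_
  calc K * (q (a - c) + q (b - d)) < K * (r / (2 * K) + r / (2 * K)) := by gcongr
    _ = r := by field_simp; ring

theorem t2Space (h : IsQuasiBanach q) : T2Space X := by
  have : T0Space X := by
    rw [t0Space_iff_uniformity]
    intro x y hxy
    rw [← sub_eq_zero]
    refine h.isQuasiNorm.eq_zero _ (le_antisymm ?_ (h.isQuasiNorm.nonneg _))
    refine le_of_forall_pos_le_add fun r hr => ?_
    rw [zero_add]
    exact (hxy _ (h.uniformity_hasBasis.mem_of_mem hr) :).le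
  infer_instance

theorem continuousSMul (h : IsQuasiBanach q) : ContinuousSMul ℂ X := by
  obtain ⟨K, hK1, hK⟩ := h.isQuasiNorm.exists_one_le
  have hK0 : 0 < K := by linarith
  refine ⟨continuous_iff_continuousAt.2 ?_⟩
  rintro ⟨a, x⟩
  rw [ContinuousAt, h.tendsto_iff]
  intro r hr
  have hx := h.isQuasiNorm.nonneg x
  have h1 : ∀ᶠ p : ℂ × X in 𝓝 (a, x), ‖p.1 - a‖ < min 1 (r / (2 * K * (q x + 1))) := by
    have : Tendsto (fun p : ℂ × X => ‖p.1 - a‖) (𝓝 (a, x)) (𝓝 0) := by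
      have hc : Continuous fun p : ℂ × X => ‖p.1 - a‖ := by fun_prop
      simpa using hc.tendsto (a, x)
    exact this.eventually (gt_mem_nhds (by positivity))
  have h2 : ∀ᶠ p : ℂ × X in 𝓝 (a, x), q (p.2 - x) < r / (2 * K * (‖a‖ + 1)) :=
    (h.tendsto_iff.1 (continuous_snd.tendsto (a, x))) _ (by positivity)
  filter_upwards [h1, h2] with ⟨b, y⟩ hb hy
  simp only [lt_min_iff] at hb hy ⊢
  have e : b • y - a • x = b • (y - x) + (b - a) • x := by
    rw [smul_sub, sub_smul]; abel
  have hbn : ‖b‖ ≤ ‖a‖ + 1 := by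
    have := norm_add_le (b - a) a
    rw [sub_add_cancel] at this
    linarith [hb.1]
  have hb2 := hb.2
  rw [lt_div_iff₀ (by positivity)] at hb2 hy
  rw [e]
  refine (hK _ _).trans_lt ?_
  rw [h.isQuasiNorm.smul, h.isQuasiNorm.smul]
  have h3 : K * (‖b‖ * q (y - x)) ≤ K * ((‖a‖ + 1) * q (y - x)) := by
    have := h.isQuasiNorm.nonneg (y - x)
    gcongr
  have h4 : K * (‖b - a‖ * q x) ≤ K * (‖b - a‖ * (q x + 1)) := by
    gcongr; linarith
  nlinarith

theorem continuous_of_bounded (h : IsQuasiBanach q) {T : X →ₗ[ℂ] X}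
    (hT : IsBoundedOperator q q T) : Continuous T := by
  obtain ⟨C, hC⟩ := hT
  refine continuous_iff_continuousAt.2 fun x => ?_
  rw [ContinuousAt, h.tendsto_iff]
  intro r hr
  filter_upwards [(h.nhds_hasBasis x).mem_of_mem (show 0 < r / (|C| + 1) by positivity)] with y hy
  have hy : q (y - x) < r / (|C| + 1) := hy
  rw [lt_div_iff₀ (by positivity)] at hy
  rw [← map_sub]
  have := h.isQuasiNorm.nonneg (y - x)
  nlinarith [hC (y - x), mul_le_mul_of_nonneg_right (le_abs_self C) this]

/-- If the geometric series of the quasi-norms is small enough, a series converges, with an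
estimate for its sum. -/
theorem exists_tendsto_sum (h : IsQuasiBanach q) {K M : ℝ} (hK1 : 1 ≤ K)
    (hK : ∀ x y, q (x + y) ≤ K * (q x + q y)) (hM : 0 < M) {u : ℕ → X}
    (hu : ∀ n, q (u n) ≤ M * (1 / (2 * K)) ^ n) :
    ∃ x, Tendsto (fun n => ∑ i ∈ Finset.range n, u i) atTop (𝓝 x) ∧ q x ≤ K * (2 * K * M + M) := by
  have hK0 : 0 < K := by linarith
  -- Peeling off the first term multiplies the remaining tail by `K`; the ratio `1 / (2K)`
  -- compensates, since `K (2KM / (2K) + M) = 2KM`.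
  have hsum : ∀ m n, q (∑ i ∈ Finset.range m, u (n + i)) ≤ 2 * K * M * (1 / (2 * K)) ^ n := by
    intro m
    induction m with
    | zero => intro n; rw [Finset.sum_range_zero, h.isQuasiNorm.map_zero]; positivity
    | succ m ih =>
      intro n
      rw [Finset.sum_range_succ']
      have e : ∑ i ∈ Finset.range m, u (n + (i + 1)) = ∑ i ∈ Finset.range m, u (n + 1 + i) :=
        Finset.sum_congr rfl fun i _ => by congr 1; ring
      rw [e, add_zero]
      calc _ ≤ K * (2 * K * M * (1 / (2 * K)) ^ (n + 1) + M * (1 / (2 * K)) ^ n) :=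
            (hK _ _).trans (by gcongr; exacts [ih _, hu n])
        _ = _ := by rw [pow_succ]; field_simp; ring
  have hc : CauchySeq fun n => ∑ i ∈ Finset.range n, u i := by
    rw [h.uniformity_hasBasis.cauchySeq_iff']
    intro r hr
    have ht : Tendsto (fun n : ℕ => 2 * K * M * (1 / (2 * K)) ^ n) atTop (𝓝 0) := by
      have := tendsto_pow_atTop_nhds_zero_of_lt_one (r := 1 / (2 * K)) (by positivity)
        (by rw [div_lt_one (by positivity)]; linarith)
      simpa using this.const_mul (2 * K * M)
    obtain ⟨N, hN⟩ := (ht.eventually (gt_mem_nhds hr)).exists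
    refine ⟨N, fun n hn => ?_⟩
    obtain ⟨m, rfl⟩ := Nat.exists_eq_add_of_le hn
    simp only [Set.mem_ofPred_eq, Finset.sum_range_add, add_sub_cancel_left]
    exact (hsum m N).trans_lt hN
  have := h.complete
  obtain ⟨x, hx⟩ := cauchySeq_tendsto_of_complete hc
  refine ⟨x, hx, ?_⟩
  -- A quasi-norm need not be continuous, so the estimate is not passed to the limit; a partial sum
  -- within `M` of `x` is used instead.
  obtain ⟨n, hn⟩ := (h.tendsto_iff.1 hx M hM).exists
  have h0 := hsum n 0
  simp only [zero_add, pow_zero, mul_one] at h0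
  have e : x = ∑ i ∈ Finset.range n, u i + (x - ∑ i ∈ Finset.range n, u i) := by abel
  rw [e]
  refine (hK _ _).trans ?_
  rw [h.isQuasiNorm.map_sub_rev] at hn
  gcongr

/-- Baire's theorem: points of a closed range are approximated by images of bounded sets. -/
theorem exists_approx_preimage (h : IsQuasiBanach q) {T : X →ₗ[ℂ] X}
    (hcl : IsClosed (Set.range T)) :
    ∃ M : ℝ, 0 < M ∧ ∀ y ∈ Set.range T, ∀ ε > 0, ∃ x, q x ≤ M * q y ∧ q (y - T x) < ε := by
  obtain ⟨K, hK1, hK⟩ := h.isQuasiNorm.exists_one_le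
  have hK0 : 0 < K := by linarith
  have hcg : (𝓤 X).IsCountablyGenerated := by
    refine HasCountableBasis.isCountablyGenerated (p := fun _ : ℕ => True)
      (s := fun n : ℕ => {z : X × X | q (z.1 - z.2) < 1 / ((n : ℝ) + 1)})
      ⟨h.uniformity_hasBasis.to_hasBasis (fun r hr => ?_) fun n _ => ⟨_, by positivity, subset_rfl⟩,
        Set.to_countable _⟩
    obtain ⟨n, hn⟩ := exists_nat_one_div_lt hr
    exact ⟨n, trivial, fun z hz => lt_trans hz hn⟩
  have := h.complete
  have : CompleteSpace (Set.range T) := hcl.completeSpace_coe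
  have : Nonempty (Set.range T) := ⟨⟨0, 0, _root_.map_zero T⟩⟩
  obtain ⟨n, y₀, hy₀⟩ := nonempty_interior_of_iUnion_of_closed
    (f := fun n : ℕ => closure {y : Set.range T | ∃ x, q x ≤ n ∧ T x = y})
    (fun _ => isClosed_closure) (Set.eq_univ_of_forall fun y => by
      obtain ⟨x, hx⟩ := y.2
      obtain ⟨n, hn⟩ := exists_nat_ge (q x)
      exact Set.mem_iUnion.2 ⟨n, subset_closure ⟨x, hn, hx⟩⟩)
  rw [mem_interior_iff_mem_nhds, nhds_subtype_eq_comap,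
    ((h.nhds_hasBasis (y₀ : X)).comap _).mem_iff] at hy₀
  obtain ⟨r, hr, hball⟩ := hy₀
  have happ : ∀ y : Set.range T, q ((y : X) - y₀) < r → ∀ ε > 0, ∃ x, q x ≤ n ∧ q (T x - y) < ε := by
    intro y hy ε hε
    have hmem := hball (a := y) hy
    rw [mem_closure_iff_nhds_basis (by
      rw [nhds_subtype_eq_comap]; exact (h.nhds_hasBasis (y : X)).comap _)] at hmem
    obtain ⟨z, ⟨x, hx, hxz⟩, hz⟩ := hmem ε hε
    refine ⟨x, hx, ?_⟩
    rw [hxz]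
    exact hz
  -- The ball around `y₀` is moved to `0` by subtracting approximate preimages of `y₀ + y` and of
  -- `y₀`.
  have hsmall : ∀ y ∈ Set.range T, q y < r → ∀ ε > 0, ∃ x, q x ≤ K * (n + n) ∧ q (y - T x) < ε := by
    rintro _ ⟨w, rfl⟩ hy ε hε
    obtain ⟨w₀, hw₀⟩ := y₀.2
    obtain ⟨x₁, hx₁, h1⟩ := happ ⟨T (w₀ + w), _, rfl⟩
      (by simpa only [map_add, hw₀, add_sub_cancel_left] using hy) (ε / (2 * K)) (by positivity)
    obtain ⟨x₂, hx₂, h2⟩ := happ y₀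
      (by rw [sub_self, h.isQuasiNorm.map_zero]; exact hr) (ε / (2 * K)) (by positivity)
    refine ⟨x₁ - x₂, (h.isQuasiNorm.sub_le hK _ _).trans (by gcongr), ?_⟩
    have e : T w - T (x₁ - x₂) = (T x₂ - y₀) - (T x₁ - T (w₀ + w)) := by
      rw [map_sub, map_add, hw₀]; abel
    rw [e]
    refine (h.isQuasiNorm.sub_le hK _ _).trans_lt ?_
    calc _ < K * (ε / (2 * K) + ε / (2 * K)) := by gcongr
      _ = ε := by field_simp; ring
  -- Rescaling `y` to quasi-norm `r / 2` gives the first summand; the `1` keeps the constant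
  -- positive when `n = 0`.
  refine ⟨K * (n + n) * 2 / r + 1, by positivity, fun y hy ε hε => ?_⟩
  rcases (h.isQuasiNorm.nonneg y).eq_or_lt with h0 | hpos
  · refine ⟨0, by rw [h.isQuasiNorm.map_zero, ← h0, mul_zero], ?_⟩
    rw [_root_.map_zero, sub_zero, ← h0]; exact hε
  · set t : ℝ := r / (2 * q y) with ht
    have ht0 : 0 < t := by positivity
    have htn : ‖(t : ℂ)‖ = t := by rw [Complex.norm_real, Real.norm_of_nonneg ht0.le]
    have htc : (t : ℂ) ≠ 0 := by exact_mod_cast ht0.ne'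
    obtain ⟨x, hx, hxy⟩ := hsmall ((t : ℂ) • y)
      (by obtain ⟨w, rfl⟩ := hy; exact ⟨(t : ℂ) • w, map_smul ..⟩)
      (by rw [h.isQuasiNorm.smul, htn, ht]; field_simp; linarith) (t * ε) (by positivity)
    refine ⟨(t : ℂ)⁻¹ • x, ?_, ?_⟩
    · rw [h.isQuasiNorm.smul, norm_inv, htn]
      calc t⁻¹ * q x ≤ t⁻¹ * (K * (n + n)) := by gcongr
        _ = K * (n + n) * 2 / r * q y := by rw [ht]; field_simp
        _ ≤ _ := by gcongr; linarith
    · have e : y - T ((t : ℂ)⁻¹ • x) = (t : ℂ)⁻¹ • ((t : ℂ) • y - T x) := by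
        rw [map_smul, smul_sub, inv_smul_smul₀ htc]
      rw [e, h.isQuasiNorm.smul, norm_inv, htn, inv_mul_lt_iff₀ ht0]
      exact hxy

/-- **Open mapping theorem** for a bounded operator with closed range. -/
theorem exists_preimage_le (h : IsQuasiBanach q) {T : X →ₗ[ℂ] X}
    (hT : IsBoundedOperator q q T) (hcl : IsClosed (Set.range T)) :
    ∃ M : ℝ, 0 < M ∧ ∀ y ∈ Set.range T, ∃ x, T x = y ∧ q x ≤ M * q y := by
  obtain ⟨K, hK1, hK⟩ := h.isQuasiNorm.exists_one_le
  have hK0 : 0 < K := by linarith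
  obtain ⟨M, hM, happ⟩ := h.exists_approx_preimage hcl
  refine ⟨K * (2 * K * M + M), by positivity, fun y hy => ?_⟩
  rcases (h.isQuasiNorm.nonneg y).eq_or_lt with h0 | hpos
  · refine ⟨0, ?_, by rw [h.isQuasiNorm.map_zero, ← h0, mul_zero]⟩
    rw [_root_.map_zero, h.isQuasiNorm.eq_zero y h0.symm]
  have := h.isUniformAddGroup
  have := h.t2Space
  choose! g hg using happ
  -- Successive approximation: `v n` is the residual after `n` corrections, and `ε` makes it decay
  -- at the ratio `1 / (2K)` that `exists_tendsto_sum` needs.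
  let ε : ℕ → ℝ := fun n => (1 / (2 * K)) ^ (n + 1) * q y
  let v : ℕ → X := fun n => Nat.rec y (fun n z => z - T (g z (ε n))) n
  have hv0 : v 0 = y := rfl
  have hv : ∀ n, v (n + 1) = v n - T (g (v n) (ε n)) := fun n => rfl
  have hε : ∀ n, 0 < ε n := fun n => by positivity
  have hvr : ∀ n, v n ∈ Set.range T := by
    intro n
    induction n with
    | zero => exact hy
    | succ n ih =>
      obtain ⟨w, hw⟩ := ih
      exact ⟨w - g (v n) (ε n), by rw [hv, map_sub, hw]⟩
  have hvq : ∀ n, q (v n) ≤ (1 / (2 * K)) ^ n * q y := by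
    intro n
    cases n with
    | zero => simp [hv0]
    | succ n => exact ((hg _ (hvr n) _ (hε n)).2).le
  have hu : ∀ n, q (g (v n) (ε n)) ≤ M * q y * (1 / (2 * K)) ^ n := fun n =>
    ((hg _ (hvr n) _ (hε n)).1).trans (by
      calc M * q (v n) ≤ M * ((1 / (2 * K)) ^ n * q y) := by gcongr; exact hvq n
        _ = _ := by ring)
  obtain ⟨x, hx, hxq⟩ := h.exists_tendsto_sum hK1 hK (mul_pos hM hpos) hu
  refine ⟨x, ?_, hxq.trans_eq (by ring)⟩
  have hTsum : ∀ n, T (∑ i ∈ Finset.range n, g (v i) (ε i)) = y - v n := by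
    intro n
    induction n with
    | zero => simp [hv0]
    | succ n ih => rw [Finset.sum_range_succ, map_add, ih, hv]; abel
  have hv_lim : Tendsto v atTop (𝓝 0) := by
    rw [h.tendsto_iff]
    intro r hr
    have ht : Tendsto (fun n : ℕ => (1 / (2 * K)) ^ n * q y) atTop (𝓝 0) := by
      have := tendsto_pow_atTop_nhds_zero_of_lt_one (r := 1 / (2 * K)) (by positivity)
        (by rw [div_lt_one (by positivity)]; linarith)
      simpa using this.mul_const (q y)
    filter_upwards [ht.eventually (gt_mem_nhds hr)] with n hn
    rw [sub_zero]
    exact (hvq n).trans_lt hn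
  have h1 := ((h.continuous_of_bounded hT).tendsto x).comp hx
  have h2 : Tendsto (fun n => y - v n) atTop (𝓝 (y - 0)) := tendsto_const_nhds.sub hv_lim
  rw [sub_zero] at h2
  exact tendsto_nhds_unique (h1.congr hTsum) h2

end IsQuasiBanach

/-! ### Measure of noncompactness -/

/-- `A` has a finite `r`-net for `q`. -/
def HasNet {X : Type*} [AddCommGroup X] (q : X → ℝ) (A : Set X) (r : ℝ) : Prop :=
  ∃ F : Set X, F.Finite ∧ ∀ a ∈ A, ∃ x ∈ F, q (a - x) ≤ r

/-- `C` bounds the factor by which `S` increases the Hausdorff measure of noncompactness. -/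
def NetBound {X : Type*} [AddCommGroup X] [Module ℂ X] (q : X → ℝ) (S : X →ₗ[ℂ] X) (C : ℝ) :
    Prop :=
  0 < C ∧ ∀ (A : Set X) (r : ℝ), 0 < r → HasNet q A r → HasNet q (S '' A) (C * r)

theorem HasNet.mono {X : Type*} [AddCommGroup X] {q : X → ℝ} {A A' : Set X} {r s : ℝ}
    (h : HasNet q A r) (hA : A' ⊆ A) (hrs : r ≤ s) : HasNet q A' s := by
  obtain ⟨F, hF, hA'⟩ := h
  refine ⟨F, hF, fun a ha => ?_⟩
  obtain ⟨x, hx, hax⟩ := hA' a (hA ha)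
  exact ⟨x, hx, hax.trans hrs⟩

theorem NetBound.of_forall_le {X : Type*} [AddCommGroup X] [Module ℂ X] {q : X → ℝ}
    {S : X →ₗ[ℂ] X} {C : ℝ} (hC : 0 < C) (hS : ∀ x, q (S x) ≤ C * q x) : NetBound q S C := by
  refine ⟨hC, fun A r _ ⟨F, hF, hA⟩ => ⟨S '' F, hF.image S, ?_⟩⟩
  rintro _ ⟨a, ha, rfl⟩
  obtain ⟨x, hx, hax⟩ := hA a ha
  refine ⟨S x, ⟨x, hx, rfl⟩, ?_⟩
  rw [← map_sub]
  exact (hS _).trans (by gcongr)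

namespace IsQuasiNorm

variable {X : Type*} [AddCommGroup X] [Module ℂ X] {q : X → ℝ}

theorem exists_forall_le_of_hasNet (h : IsQuasiNorm q) {A : Set X} {r : ℝ} (hA : HasNet q A r) :
    ∃ M, ∀ a ∈ A, q a ≤ M := by
  obtain ⟨K, hK1, hK⟩ := h.exists_one_le
  have hK0 : 0 < K := by linarith
  obtain ⟨F, hF, hFA⟩ := hA
  obtain ⟨M, hM⟩ := (hF.image q).bddAbove
  refine ⟨K * (r + M), fun a ha => ?_⟩
  obtain ⟨x, hx, hax⟩ := hFA a ha
  calc q a = q (a - x + x) := by rw [sub_add_cancel]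
    _ ≤ K * (q (a - x) + q x) := hK _ _
    _ ≤ K * (r + M) := by gcongr; exact hM ⟨x, hx, rfl⟩

theorem exists_netBound (h : IsQuasiNorm q) {S : X →ₗ[ℂ] X} (hS : IsBoundedOperator q q S) :
    ∃ C, NetBound q S C := by
  obtain ⟨C, hC⟩ := hS
  refine ⟨|C| + 1, NetBound.of_forall_le (by positivity) fun x => (hC x).trans ?_⟩
  have := h.nonneg x
  gcongr
  linarith [le_abs_self C]

end IsQuasiNorm

namespace NetBound

variable {X : Type*} [AddCommGroup X] [Module ℂ X] {q : X → ℝ} {S S' : X →ₗ[ℂ] X} {C D : ℝ}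

theorem mono (h : NetBound q S C) (hCD : C ≤ D) : NetBound q S D :=
  ⟨h.1.trans_le hCD, fun A r hr hA => (h.2 A r hr hA).mono subset_rfl (by gcongr)⟩

theorem add (h : NetBound q S C) (h' : NetBound q S' D) {K : ℝ} (hK0 : 0 < K)
    (hK : ∀ x y, q (x + y) ≤ K * (q x + q y)) : NetBound q (S + S') (K * (C + D)) := by
  refine ⟨mul_pos hK0 (add_pos h.1 h'.1), fun A r hr hA => ?_⟩
  obtain ⟨F, hF, hFA⟩ := h.2 A r hr hA
  obtain ⟨G, hG, hGA⟩ := h'.2 A r hr hA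
  refine ⟨Set.image2 (· + ·) F G, hF.image2 _ hG, ?_⟩
  rintro _ ⟨a, ha, rfl⟩
  obtain ⟨x, hx, hax⟩ := hFA (S a) ⟨a, ha, rfl⟩
  obtain ⟨y, hy, hay⟩ := hGA (S' a) ⟨a, ha, rfl⟩
  refine ⟨x + y, ⟨x, hx, y, hy, rfl⟩, ?_⟩
  rw [LinearMap.add_apply, add_sub_add_comm]
  calc _ ≤ K * (q (S a - x) + q (S' a - y)) := hK _ _
    _ ≤ K * (C * r + D * r) := by gcongr
    _ = _ := by ring

theorem mul (h : NetBound q S C) (h' : NetBound q S' D) : NetBound q (S * S') (C * D) := by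
  refine ⟨mul_pos h.1 h'.1, fun A r hr hA => ?_⟩
  have := h.2 _ _ (mul_pos h'.1 hr) (h'.2 A r hr hA)
  rwa [← Set.image_comp, ← mul_assoc] at this

theorem smul (hq : IsQuasiNorm q) (h : NetBound q S C) {a : ℂ} (ha : a ≠ 0) :
    NetBound q (a • S) (‖a‖ * C) := by
  have := (NetBound.of_forall_le (S := a • LinearMap.id) (norm_pos_iff.2 ha)
    fun x => (hq.smul a x).le).mul h
  rwa [show (a • LinearMap.id : X →ₗ[ℂ] X) * S = a • S from by ext; simp] at this

end NetBound

namespace IsQuasiBanach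

variable {X : Type*} [AddCommGroup X] [Module ℂ X] [UniformSpace X] {q : X → ℝ}

theorem totallyBounded (h : IsQuasiBanach q) {A : Set X} (hA : ∀ r > 0, HasNet q A r) :
    TotallyBounded A := by
  rw [h.uniformity_hasBasis.totallyBounded_iff]
  intro r hr
  obtain ⟨F, hF, hFA⟩ := hA (r / 2) (half_pos hr)
  refine ⟨F, hF, fun a ha => ?_⟩
  obtain ⟨x, hx, hax⟩ := hFA a ha
  exact Set.mem_iUnion₂.2 ⟨x, hx, hax.trans_lt (half_lt_self hr)⟩

theorem hasNet_of_totallyBounded (h : IsQuasiBanach q) {A : Set X} (hA : TotallyBounded A)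
    {r : ℝ} (hr : 0 < r) : HasNet q A r := by
  obtain ⟨F, hF, hFA⟩ := h.uniformity_hasBasis.totallyBounded_iff.1 hA r hr
  refine ⟨F, hF, fun a ha => ?_⟩
  obtain ⟨x, hx, hax⟩ := Set.mem_iUnion₂.1 (hFA ha)
  exact ⟨x, hx, le_of_lt hax⟩

/-- Riesz's theorem: the identity does not decrease the measure of noncompactness. -/
theorem one_le_of_netBound_one (h : IsQuasiBanach q) (hdim : ¬ FiniteDimensional ℂ X) {C : ℝ}
    (hC : NetBound q 1 C) : 1 ≤ C := by
  by_contra! hlt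
  have := h.isUniformAddGroup
  have := h.t2Space
  have := h.continuousSMul
  refine hdim (FiniteDimensional.of_totallyBounded_nhds_zero ℂ
    ((h.nhds_hasBasis 0).mem_of_mem one_pos) (h.totallyBounded fun r hr => ?_))
  -- A factor `C < 1` for the identity refines any net of the unit ball again and again, so the ball
  -- would be totally bounded.
  have hpow : ∀ n : ℕ, HasNet q {y | q (y - 0) < 1} (C ^ n) := by
    intro n
    induction n with
    | zero => exact ⟨{0}, Set.finite_singleton _, fun a ha => ⟨0, rfl, by
        rw [pow_zero]; exact le_of_lt ha⟩⟩
    | succ n ih =>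
      have := hC.2 _ _ (pow_pos hC.1 n) ih
      rw [← pow_succ'] at this
      exact this.mono (fun a ha => ⟨a, ha, rfl⟩) le_rfl
  obtain ⟨n, hn⟩ := exists_pow_lt_of_lt_one hr hlt
  exact (hpow n).mono subset_rfl hn.le

/-- Coordinates on `E` are continuous, so by homogeneity they map bounded sets into a closed ball,
whose image back in `X` is compact. -/
theorem hasNet_of_finiteDimensional (h : IsQuasiBanach q) (E : Submodule ℂ X)
    [FiniteDimensional ℂ E] (M : ℝ) {r : ℝ} (hr : 0 < r) :
    HasNet q {x | x ∈ E ∧ q x ≤ M} r := by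
  have := h.isUniformAddGroup
  have := h.t2Space
  have := h.continuousSMul
  let e : E ≃L[ℂ] (Fin (Module.finrank ℂ E) → ℂ) :=
    ContinuousLinearEquiv.ofFinrankEq (Module.finrank_fin_fun ℂ).symm
  have hcont : Tendsto (fun x : E => ‖e x‖) (𝓝 0) (𝓝 0) := by
    have : Continuous fun x : E => ‖e x‖ := by fun_prop
    simpa using this.tendsto 0
  have hev := hcont.eventually (gt_mem_nhds one_pos)
  rw [nhds_subtype_eq_comap, ((h.nhds_hasBasis ((0 : E) : X)).comap _).eventually_iff] at hev
  obtain ⟨δ, hδ, hball⟩ := hev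
  have hle : ∀ x : E, q x ≤ M → ‖e x‖ ≤ (|M| + 1) / δ := by
    intro x hx
    have ht0 : 0 < (|M| + 1) / δ := by positivity
    set t : ℝ := (|M| + 1) / δ with ht
    have htn : ‖(t : ℂ)‖ = t := by rw [Complex.norm_real, Real.norm_of_nonneg ht0.le]
    have h1 : ‖e ((t : ℂ)⁻¹ • x)‖ < 1 := by
      apply hball
      change q (((t : ℂ)⁻¹ • (x : X)) - 0) < δ
      rw [sub_zero, h.isQuasiNorm.smul, norm_inv, htn, inv_mul_lt_iff₀ ht0, ht,
        div_mul_cancel₀ _ hδ.ne']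
      linarith [le_abs_self M]
    rw [map_smul, norm_smul, norm_inv, htn, inv_mul_lt_iff₀ ht0, mul_one] at h1
    exact h1.le
  have hcomp : IsCompact ((fun v => ((e.symm v : E) : X)) '' Metric.closedBall 0 ((|M| + 1) / δ)) :=
    (isCompact_closedBall _ _).image (continuous_subtype_val.comp e.symm.continuous)
  refine (h.hasNet_of_totallyBounded hcomp.totallyBounded hr).mono ?_ le_rfl
  rintro x ⟨hxE, hxM⟩
  exact ⟨e ⟨x, hxE⟩, mem_closedBall_zero_iff.2 (hle ⟨x, hxE⟩ hxM), by simp⟩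

/-- A semi-Fredholm operator does not decrease the measure of noncompactness by more than a
constant factor. -/
theorem exists_hasNet_of_isSemiFredholm (h : IsQuasiBanach q) {S : X →ₗ[ℂ] X}
    (hS : IsBoundedOperator q q S) (hF : IsSemiFredholm S) :
    ∃ c : ℝ, 0 < c ∧ ∀ (A : Set X) (M r : ℝ), (∀ a ∈ A, q a ≤ M) → 0 < r →
      HasNet q (S '' A) r → HasNet q A (c * r) := by
  obtain ⟨K, hK1, hK⟩ := h.isQuasiNorm.exists_one_le
  have hK0 : 0 < K := by linarith
  obtain ⟨N, hN, hpre⟩ := h.exists_preimage_le hS hF.2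
  -- The bound `M` on `A` affects only the size of the net `H` in the kernel, not this constant.
  refine ⟨K * (N * (K * (1 + 1)) + 1), by positivity, fun A M r hM hr hA => ?_⟩
  obtain ⟨F, hFin, hFA⟩ := hA
  -- Only net points near some `S a` are kept, so that each has a representative `g x` in `A`. Then
  -- `a - g x` is a small preimage `w` plus a bounded kernel element, which `H` approximates.
  let G : Set X := {x ∈ F | ∃ a ∈ A, q (S a - x) ≤ r}
  have hG : ∀ x ∈ G, ∃ a ∈ A, q (S a - x) ≤ r := fun x hx => hx.2
  choose! g hgA hg using hG
  have hker : FiniteDimensional ℂ (LinearMap.ker S) := hF.1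
  obtain ⟨H, hHfin, hH⟩ := h.hasNet_of_finiteDimensional (LinearMap.ker S)
    (K * (K * (M + M) + N * (K * (r + r)))) hr
  refine ⟨Set.image2 (fun x z => g x + z) G H, (hFin.subset fun x hx => hx.1).image2 _ hHfin, ?_⟩
  intro a ha
  obtain ⟨x, hx, hax⟩ := hFA (S a) ⟨a, ha, rfl⟩
  have hxG : x ∈ G := ⟨hx, a, ha, hax⟩
  obtain ⟨w, hw, hwq⟩ := hpre (S (a - g x)) ⟨_, rfl⟩
  have hSq : q (S (a - g x)) ≤ K * (r + r) := by
    have e : S (a - g x) = (S a - x) - (S (g x) - x) := by rw [map_sub]; abel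
    rw [e]
    refine (h.isQuasiNorm.sub_le hK _ _).trans ?_
    gcongr
    exact hg x hxG
  have hwq' : q w ≤ N * (K * (r + r)) := hwq.trans (by gcongr)
  have hz : a - g x - w ∈ LinearMap.ker S := by
    rw [LinearMap.mem_ker, map_sub, hw, sub_self]
  have hzq : q (a - g x - w) ≤ K * (K * (M + M) + N * (K * (r + r))) := by
    refine (h.isQuasiNorm.sub_le hK _ _).trans ?_
    gcongr
    refine (h.isQuasiNorm.sub_le hK _ _).trans ?_
    gcongr
    exacts [hM a ha, hM _ (hgA x hxG)]
  obtain ⟨z, hzH, hzz⟩ := hH _ ⟨hz, hzq⟩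
  refine ⟨g x + z, ⟨x, hxG, z, hzH, rfl⟩, ?_⟩
  have e : a - (g x + z) = w + (a - g x - w - z) := by abel
  rw [e]
  calc _ ≤ K * (q w + q (a - g x - w - z)) := hK _ _
    _ ≤ K * (N * (K * (r + r)) + r) := by gcongr
    _ = _ := by ring

end IsQuasiBanach

/-! ### Application to polynomials in `T` -/

namespace IsQuasiNorm

variable {X : Type*} [AddCommGroup X] [Module ℂ X] {q : X → ℝ}

theorem isBoundedOperator_sub_smul_id (h : IsQuasiNorm q) {T : X →ₗ[ℂ] X}
    (hT : IsBoundedOperator q q T) (z : ℂ) :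
    IsBoundedOperator q q (T - z • (LinearMap.id : X →ₗ[ℂ] X)) := by
  obtain ⟨K, hK1, hK⟩ := h.exists_one_le
  have hK0 : 0 < K := by linarith
  obtain ⟨C, hC⟩ := hT
  refine ⟨K * (C + ‖z‖), fun x => (h.sub_le hK _ _).trans ?_⟩
  calc K * (q (T x) + q (z • x)) ≤ K * (C * q x + ‖z‖ * q x) := by
        gcongr
        exacts [hC x, (h.smul z x).le]
    _ = _ := by ring

end IsQuasiNorm

theorem NetBound.exists_forall_le_of_hasNet {X : Type*} [AddCommGroup X] [Module ℂ X] {q : X → ℝ}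
    (hq : IsQuasiNorm q) {S : X →ₗ[ℂ] X} {C : ℝ} (h : NetBound q S C) {A : Set X} {r : ℝ}
    (hr : 0 < r) (hA : HasNet q A r) : ∃ M, ∀ a ∈ S '' A, q a ≤ M :=
  hq.exists_forall_le_of_hasNet (h.2 A r hr hA)

/-- Working in `ℂ[X]` rather than with operators supplies the commutativity that the spectral radius
argument requires. Infinite dimension enters only through the bound at `1`. -/
theorem IsQuasiBanach.isQuasiBound_netBound_aeval {X : Type*} [AddCommGroup X] [Module ℂ X]
    [UniformSpace X] {q : X → ℝ} (h : IsQuasiBanach q) (hdim : ¬ FiniteDimensional ℂ X)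
    {T : X →ₗ[ℂ] X} (hT : IsBoundedOperator q q T) :
    ∃ K, IsQuasiBound (R := Polynomial ℂ) K fun f C => NetBound q (Polynomial.aeval T f) C := by
  obtain ⟨K, hK1, hK⟩ := h.isQuasiNorm.exists_one_le
  have hK0 : 0 < K := by linarith
  have h1 : NetBound q (1 : X →ₗ[ℂ] X) 1 :=
    NetBound.of_forall_le one_pos fun x => by simp
  have hconst : ∀ a : ℂ, ∃ C, NetBound q (algebraMap ℂ (X →ₗ[ℂ] X) a) C := fun a =>
    h.isQuasiNorm.exists_netBound ⟨‖a‖, fun x => by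
      rw [Module.algebraMap_end_apply]; exact (h.isQuasiNorm.smul a x).le⟩
  refine ⟨K, fun h => h.1, fun h hCD => h.mono hCD, fun h h' => ?_, fun h h' => ?_,
    fun a ha hf => ?_, ?_, fun hC => ?_, fun f => ?_⟩
  · rw [map_add]; exact h.add h' hK0 hK
  · rw [map_mul]; exact h.mul h'
  · rw [map_smul]; exact hf.smul h.isQuasiNorm ha
  · rwa [map_one]
  · rw [map_one] at hC; exact h.one_le_of_netBound_one hdim hC
  · obtain ⟨D, hD⟩ := h.isQuasiNorm.exists_netBound hT
    induction f using Polynomial.induction_on' with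
    | add f g hf hg =>
      obtain ⟨C, hC⟩ := hf
      obtain ⟨C', hC'⟩ := hg
      exact ⟨_, by rw [map_add]; exact hC.add hC' hK0 hK⟩
    | monomial n a =>
      obtain ⟨C, hC⟩ := hconst a
      have hp : ∀ n : ℕ, NetBound q (T ^ n) (D ^ n) := by
        intro n
        induction n with
        | zero => simpa using h1
        | succ n ih => rw [pow_succ, pow_succ]; exact ih.mul hD
      exact ⟨_, by rw [Polynomial.aeval_monomial]; exact hC.mul (hp n)⟩

theorem mainTheorem5 {X : Type*} [AddCommGroup X] [Module ℂ X] [UniformSpace X]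
    (q : X → ℝ) (hX : IsQuasiBanach q) (hdim : ¬ FiniteDimensional ℂ X)
    (T : X →ₗ[ℂ] X) (hT : IsBoundedOperator q q T) :
    ∃ l : ℂ, ¬ IsSemiFredholm (T - l • (LinearMap.id : X →ₗ[ℂ] X)) := by
  by_contra! H
  obtain ⟨K, hB⟩ := hX.isQuasiBound_netBound_aeval hdim hT
  refine hB.not_forall_bounded_below Polynomial.X fun z => ?_
  obtain ⟨c, hc, hnet⟩ := hX.exists_hasNet_of_isSemiFredholm
    (hX.isQuasiNorm.isBoundedOperator_sub_smul_id hT z) (H z)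
  refine ⟨c, hc, fun f C hf => ⟨mul_pos hc hf.1, fun A r hr hA => ?_⟩⟩
  have e : Polynomial.aeval T (Polynomial.X - algebraMap ℂ (Polynomial ℂ) z) =
      T - z • (LinearMap.id : X →ₗ[ℂ] X) := by
    rw [map_sub, Polynomial.aeval_X, AlgHom.commutes]
    rfl
  have h1 := hf.2 A r hr hA
  rw [map_mul, e, Module.End.mul_eq_comp, LinearMap.coe_comp, Set.image_comp] at h1
  -- Any net bound for `f(T)` shows that the image of `A` is bounded, as the transfer of nets
  -- requires.
  obtain ⟨D, hD⟩ := hB.exists_bound f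
  obtain ⟨M, hM⟩ := hD.exists_forall_le_of_hasNet hX.isQuasiNorm hr hA
  rw [mul_assoc]
  exact hnet _ M _ hM (mul_pos hf.1 hr) h1
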